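/- All graphs are finite and simple. For a graph $G$ with $n$ vertices and $e$ edges put $\mathrm{free}(G)=2n-e-3$. A subgraph of $G$ (not necessarily induced) is called proper if it is different from $G$ and has at least three vertices. $G$ is a Laman (maximally independent) graph if $\mathrm{free}(G)=0$ and $\mathrm{free}(S)\ge 0$ for every proper subgraph $S$ of $G$; a Laman graph is basic if none of its proper subgraphs is itself a Laman graph. A graph is $3$-connected if it has more than $3$ vertices and no set $U$ of two vertices separates it, that is, there are no $U$ with $|U|=2$ and two vertices $a,b\notin U$ such that every path from $a$ to $b$ meets $U$. A graph is planar if it can be drawn in the Euclidean plane, with distinct points for vertices and simple continuous arcs for edges, so that arcs meet vertices and each other only at common ends. Corollary. Every basic Laman graph $G$ with more than $3$ vertices is $3$-connected and non-planar. -/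

import Mathlib

namespace SimpleGraph

variable {V : Type*}

/-- The freedom number `2n - e - 3` of a graph with `n` vertices and `e` edges, as an integer. -/
noncomputable def freedomNumber (G : SimpleGraph V) : ℤ :=
  2 * (Nat.card V : ℤ) - (Nat.card G.edgeSet : ℤ) - 3

/-- A subgraph of `G` (not necessarily vertex induced) is proper if it is not equal to `G` and
has at least three vertices. -/
def Subgraph.IsProper {G : SimpleGraph V} (S : G.Subgraph) : Prop :=
  S ≠ ⊤ ∧ 3 ≤ Nat.card S.verts

/-- `G` and all its proper subgraphs have a non-negative freedom number. -/
def IsIndependent (G : SimpleGraph V) : Prop :=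
  0 ≤ G.freedomNumber ∧ ∀ S : G.Subgraph, S.IsProper → 0 ≤ S.coe.freedomNumber

/-- A Laman (maximally independent) graph: independent with freedom number zero. -/
def IsLaman (G : SimpleGraph V) : Prop :=
  G.IsIndependent ∧ G.freedomNumber = 0

/-- A Laman graph is basic if none of its proper subgraphs is maximally independent. -/
def IsBasicLaman (G : SimpleGraph V) : Prop :=
  G.IsLaman ∧ ∀ S : G.Subgraph, S.IsProper → ¬ S.coe.IsLaman

/-- `U` separates `G`: some two vertices outside `U` are such that every walk joining them meets
`U`. (They are then distinct, because the trivial walk at a vertex outside `U` avoids `U`.) -/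
def IsSeparatedBy (G : SimpleGraph V) (U : Finset V) : Prop :=
  ∃ a b : V, a ∉ U ∧ b ∉ U ∧ ∀ w : G.Walk a b, ∃ x ∈ w.support, x ∈ U

/-- `G` has more than `m` vertices and no separating set of order `m - 1`. -/
def IsMConnected (G : SimpleGraph V) (m : ℕ) : Prop :=
  m < Nat.card V ∧ ∀ U : Finset V, U.card + 1 = m → ¬ G.IsSeparatedBy U

/-- A drawing of `G` in the Euclidean plane without edge crossings. Vertices are distinct points,
edges are simple continuous arcs joining the points of their end vertices, the interior of an arc
contains no vertex point, and the interiors of distinct arcs are disjoint. -/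
structure PlaneDrawing (G : SimpleGraph V) where
  point : V → EuclideanSpace ℝ (Fin 2)
  arc : G.edgeSet → C(unitInterval, EuclideanSpace ℝ (Fin 2))
  point_injective : Function.Injective point
  arc_injective : ∀ e, Function.Injective (arc e)
  arc_ends : ∀ e, s(arc e 0, arc e 1) = Sym2.map point (e : Sym2 V)
  arc_ne_point : ∀ e, ∀ t ∈ Set.Ioo (0 : unitInterval) 1, ∀ v, arc e t ≠ point v
  arc_ne_arc : ∀ e f, e ≠ f → ∀ s ∈ Set.Ioo (0 : unitInterval) 1,
    ∀ t ∈ Set.Ioo (0 : unitInterval) 1, arc e s ≠ arc f t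

/-- `G` can be drawn in the plane without edge crossings. -/
def IsPlanar (G : SimpleGraph V) : Prop :=
  Nonempty G.PlaneDrawing

end SimpleGraph

/-! Connectivity is a count. If two vertices separate `G`, two proper subgraphs that share just
these vertices cover all edges, and their freedom numbers add up to at most `free(G) + 1 = 1`. In a
basic Laman graph each of them is at least `1`, a contradiction (`IsBasicLaman.isMConnected_three`).
The same bound excludes triangles, whose freedom number is `0`.

For non-planarity, `e = 2n - 3` contradicts the bound `e ≤ 2n - 4` for planar connected
triangle-free graphs with a cycle (`IsPlanar.card_edgeSet_add_four_le`). That bound follows from the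
inequality `e + 2 ≤ f + n` of Euler's formula (`exists_faces`) by double counting: at least four
edges lie at each face (`not_isAcyclic_faceEdges`), and at most two faces at each edge
(`component_eq_of_mem_faceEdges`).

The plane topology rests on continuous logarithms instead of the Jordan curve theorem: `p` and `q`
lie in the same component of the complement of a compact `K` exactly when `(z - p) / (z - q)` has a
continuous logarithm on `K`. Adding an arc to `K` becomes a question of whether logarithms on `K`
and on the arc can be matched at the two ends. -/

section PlaneTopology

open Set Topology Metric

/-! ### Continuous logarithms: existence, uniqueness, gluing. -/

/-- `f` has a continuous logarithm on `Z`. -/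
def HasLogOn (f : ℂ → ℂ) (Z : Set ℂ) : Prop :=
  ∃ g : ℂ → ℂ, ContinuousOn g Z ∧ ∀ z ∈ Z, Complex.exp (g z) = f z

namespace HasLogOn

variable {f f₁ f₂ : ℂ → ℂ} {Z Z' : Set ℂ}

lemma mono (h : HasLogOn f Z) (hZ : Z' ⊆ Z) : HasLogOn f Z' := by
  obtain ⟨g, hg, he⟩ := h
  exact ⟨g, hg.mono hZ, fun z hz => he z (hZ hz)⟩

lemma congr (h : HasLogOn f₁ Z) (hf : EqOn f₁ f₂ Z) : HasLogOn f₂ Z := by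
  obtain ⟨g, hg, he⟩ := h
  exact ⟨g, hg, fun z hz => (he z hz).trans (hf hz)⟩

lemma mul (h₁ : HasLogOn f₁ Z) (h₂ : HasLogOn f₂ Z) : HasLogOn (fun z => f₁ z * f₂ z) Z := by
  obtain ⟨g₁, hg₁, he₁⟩ := h₁
  obtain ⟨g₂, hg₂, he₂⟩ := h₂
  exact ⟨fun z => g₁ z + g₂ z, hg₁.add hg₂, fun z hz => by
    simp only [Complex.exp_add, he₁ z hz, he₂ z hz]⟩

lemma zpow (h : HasLogOn f Z) (k : ℤ) : HasLogOn (fun z => f z ^ k) Z := by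
  obtain ⟨g, hg, he⟩ := h
  exact ⟨fun z => k * g z, continuousOn_const.mul hg, fun z hz => by
    simp only [Complex.exp_int_mul, he z hz]⟩

end HasLogOn

lemma hasLogOn_iff_exists_subtype {f : ℂ → ℂ} {Z : Set ℂ} :
    HasLogOn f Z ↔ ∃ g : C(Z, ℂ), ∀ z : Z, Complex.exp (g z) = f z := by
  classical
  constructor
  · rintro ⟨g, hg, he⟩
    exact ⟨⟨Z.domRestrict g, hg.domRestrict⟩, fun z => he z z.2⟩
  · rintro ⟨g, he⟩
    refine ⟨fun z => if h : z ∈ Z then g ⟨z, h⟩ else 0, ?_, fun z hz => ?_⟩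
    · rw [continuousOn_iff_continuous_domRestrict]
      convert g.continuous using 1
      ext z
      simp
    · simp [hz, he ⟨z, hz⟩]

/-- Continuous logarithms propagate along homotopies of nowhere vanishing functions. -/
lemma exists_log_of_homotopy {X : Type*} [TopologicalSpace X] (H : unitInterval × X → ℂ)
    (hH : Continuous H) (h0 : ∀ x, H x ≠ 0) (g₀ : C(X, ℂ))
    (hg₀ : ∀ x, Complex.exp (g₀ x) = H (0, x)) :
    ∃ g : C(X, ℂ), ∀ x, Complex.exp (g x) = H (1, x) := by
  have hc := Complex.isCoveringMap_exp
  let H' : C(unitInterval × X, {z : ℂ // z ≠ 0}) := ⟨fun x => ⟨H x, h0 x⟩, by fun_prop⟩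
  have hs : ∀ x, H' (0, x) = ⟨Complex.exp (g₀ x), Complex.exp_ne_zero _⟩ := fun x =>
    Subtype.ext (hg₀ x).symm
  let L := hc.liftHomotopy H' g₀ hs
  refine ⟨⟨fun x => L (1, x), by fun_prop⟩, fun x => ?_⟩
  have := congrFun (hc.liftHomotopy_lifts H' g₀ hs) (1, x)
  exact congrArg Subtype.val this

/-- A nowhere vanishing continuous function on a space with a contraction has a logarithm. -/
lemma exists_log_of_contraction {X : Type*} [TopologicalSpace X] (c : unitInterval × X → X)
    (hc : Continuous c) (x₀ : X) (hc0 : ∀ x, c (0, x) = x₀) (hc1 : ∀ x, c (1, x) = x)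
    (f : X → ℂ) (hf : Continuous f) (h0 : ∀ x, f x ≠ 0) :
    ∃ g : C(X, ℂ), ∀ x, Complex.exp (g x) = f x := by
  obtain ⟨g, hg⟩ := exists_log_of_homotopy (fun x => f (c x)) (hf.comp hc) (fun _ => h0 _)
    (ContinuousMap.const X (Complex.log (f x₀))) (fun x => by
      simp [hc0, Complex.exp_log (h0 x₀)])
  exact ⟨g, fun x => by simpa [hc1] using hg x⟩

lemma hasLogOn_univ {f : ℂ → ℂ} (hf : Continuous f) (h0 : ∀ z, f z ≠ 0) :
    HasLogOn f univ := by
  obtain ⟨g, hg⟩ := exists_log_of_contraction (fun x : unitInterval × ℂ => (x.1 : ℂ) * x.2)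
    (by fun_prop) 0 (by simp) (by simp) f hf h0
  exact ⟨g, g.continuous.continuousOn, fun z _ => hg z⟩

lemma hasLogOn_arc {f : ℂ → ℂ} (α : C(unitInterval, ℂ)) (hα : Function.Injective α)
    (hf : ContinuousOn f (range α)) (h0 : ∀ z ∈ range α, f z ≠ 0) : HasLogOn f (range α) := by
  obtain ⟨g, hg⟩ := exists_log_of_contraction (fun x : unitInterval × unitInterval => x.1 * x.2)
    (by fun_prop) 0 (by simp) (by simp) (fun t => f (α t))
    (hf.comp_continuous α.continuous fun t => mem_range_self t) (fun t => h0 _ (mem_range_self t))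
  have hemb : IsClosedEmbedding α := α.continuous.isClosedEmbedding hα
  rw [hasLogOn_iff_exists_subtype]
  let φ := hemb.isEmbedding.toHomeomorph
  refine ⟨⟨fun z => g (φ.symm z), by fun_prop⟩, fun z => ?_⟩
  have : α (φ.symm z) = z := congrArg Subtype.val (φ.apply_symm_apply z)
  simp [hg, this]

/-- Moving `a` to `b` off `Z` gives a logarithm of `(z - a) / (z - b)` on `Z`. -/
lemma hasLogOn_div_of_path {Z : Set ℂ} {a b : ℂ} (γ : Path a b) (hγ : ∀ t, γ t ∉ Z) :
    HasLogOn (fun z => (z - a) / (z - b)) Z := by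
  have hb : ∀ z : Z, (z : ℂ) - b ≠ 0 := fun z h => hγ 1 (by
    rw [γ.target, ← sub_eq_zero.1 h]; exact z.2)
  have hn : ∀ (z : Z) t, (z : ℂ) - γ t ≠ 0 := fun z t h => hγ t (by
    rw [← sub_eq_zero.1 h]; exact z.2)
  rw [hasLogOn_iff_exists_subtype]
  obtain ⟨g, hg⟩ := exists_log_of_homotopy
    (fun x : unitInterval × Z => ((x.2 : ℂ) - γ (unitInterval.symm x.1)) / ((x.2 : ℂ) - b))
    (Continuous.div (by fun_prop) (by fun_prop) fun x => hb x.2)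
    (fun x => div_ne_zero (hn _ _) (hb _)) (ContinuousMap.const Z 0)
    (fun z => by simp [div_self (hb z)])
  exact ⟨g, fun z => by simpa using hg z⟩

/-- Two continuous logarithms of the same function differ by a constant on preconnected sets. -/
lemma log_sub_log_const {S : Set ℂ} (hS : IsPreconnected S) {f g₁ g₂ : ℂ → ℂ}
    (h₁ : ContinuousOn g₁ S) (h₂ : ContinuousOn g₂ S)
    (e₁ : ∀ z ∈ S, Complex.exp (g₁ z) = f z) (e₂ : ∀ z ∈ S, Complex.exp (g₂ z) = f z) :
    ∃ n : ℤ, ∀ z ∈ S, g₁ z = g₂ z + n * (2 * Real.pi * Complex.I) := by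
  have hex : ∀ z ∈ S, ∃ n : ℤ, g₁ z = g₂ z + n * (2 * Real.pi * Complex.I) := fun z hz =>
    Complex.exp_eq_exp_iff_exists_int.1 ((e₁ z hz).trans (e₂ z hz).symm)
  have hpi : (2 * Real.pi * Complex.I : ℂ) ≠ 0 := Complex.two_pi_I_ne_zero
  rcases S.eq_empty_or_nonempty with rfl | ⟨x, hx⟩
  · exact ⟨0, by simp⟩
  -- The difference divided by `2πi` is continuous with integer values; integers are discrete in
  -- `ℂ`, so it is constant on a preconnected set.
  have hd : IsDiscrete (range ((↑) : ℤ → ℂ)) := by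
    convert (Complex.isUniformEmbedding_ofReal.isEmbedding.comp
      Int.isClosedEmbedding_coe_real.isEmbedding).isDiscrete_range using 2
    ext n
    simp
  have hc : ContinuousOn (fun z => (g₁ z - g₂ z) / (2 * Real.pi * Complex.I)) S :=
    (h₁.sub h₂).div_const _
  have hm : MapsTo (fun z => (g₁ z - g₂ z) / (2 * Real.pi * Complex.I)) S
      (range ((↑) : ℤ → ℂ)) := by
    intro z hz
    obtain ⟨n, hn⟩ := hex z hz
    refine ⟨n, ?_⟩
    simp only [hn]
    field_simp
    ring
  obtain ⟨n, hn⟩ := hm hx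
  refine ⟨n, fun z hz => ?_⟩
  have := hS.constant_of_mapsTo hd hc hm hx hz
  simp only at this hn
  rw [← hn] at this
  rw [eq_div_iff hpi] at this
  rw [this]
  ring

/-- Along the parametrization `c` of the circle by the real line, `g ∘ c` has period `2π`, whereas
the explicit logarithm `k (log r + it)` grows by `2πik` in each period; yet they differ by a
constant. -/
lemma not_hasLogOn_sphere (p : ℂ) {r : ℝ} (hr : 0 < r) {k : ℤ} (hk : k ≠ 0) :
    ¬ HasLogOn (fun z => (z - p) ^ k) (sphere p r) := by
  rintro ⟨g, hg, he⟩
  let c : ℂ → ℂ := fun t => p + Complex.exp (Real.log r + t * Complex.I)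
  let S : Set ℂ := ((↑) : ℝ → ℂ) '' univ
  have hS : IsPreconnected S := isPreconnected_univ.image _ Complex.continuous_ofReal.continuousOn
  have hcS : ∀ t ∈ S, c t ∈ sphere p r := by
    rintro _ ⟨t, -, rfl⟩
    simp [c, Complex.norm_exp, Real.exp_log hr]
  obtain ⟨n, hn⟩ := log_sub_log_const hS (f := fun t => (c t - p) ^ k)
    (g₁ := fun t => g (c t)) (g₂ := fun t => k * (Real.log r + t * Complex.I))
    (hg.comp (by fun_prop) hcS) (by fun_prop) (fun t ht => he _ (hcS t ht))
    (fun t _ => by simp [c, Complex.exp_int_mul])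
  have h0 := hn 0 ⟨0, trivial, by simp⟩
  have h1 := hn (2 * Real.pi) ⟨2 * Real.pi, trivial, by simp⟩
  have hper : c (2 * Real.pi) = c 0 := by simp [c, Complex.exp_add]
  rw [hper, h0] at h1
  have h2 : (k : ℂ) * (2 * Real.pi * Complex.I) = 0 := by linear_combination -h1
  rcases mul_eq_zero.1 h2 with h | h
  · exact hk (by exact_mod_cast h)
  · exact Complex.two_pi_I_ne_zero h

/-- Gluing logarithms along two closed sets. -/
lemma hasLogOn_union {f g h : ℂ → ℂ} {K A : Set ℂ} (hK : IsClosed K) (hA : IsClosed A)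
    (hg : ContinuousOn g K) (hh : ContinuousOn h A) (eg : ∀ z ∈ K, Complex.exp (g z) = f z)
    (eh : ∀ z ∈ A, Complex.exp (h z) = f z) (hgh : ∀ z ∈ K, z ∈ A → g z = h z) :
    HasLogOn f (K ∪ A) := by
  classical
  have e1 : EqOn (fun z => if z ∈ K then g z else h z) g K := fun z hz => by simp [hz]
  have e2 : EqOn (fun z => if z ∈ K then g z else h z) h A := fun z hz => by
    by_cases hk : z ∈ K
    · simp [hk, hgh z hk hz]
    · simp [hk]
  refine ⟨fun z => if z ∈ K then g z else h z,
    (hg.congr e1).union_of_isClosed (hh.congr e2) hK hA, ?_⟩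
  rintro z (hz | hz)
  · exact (congrArg _ (e1 hz)).trans (eg z hz)
  · exact (congrArg _ (e2 hz)).trans (eh z hz)

/-! ### Logarithms and components of the complement of a compact set. -/

lemma isPreconnected_lt_norm {r : ℝ} (hr : 0 < r) : IsPreconnected {z : ℂ | r < ‖z‖} := by
  have : {z : ℂ | r < ‖z‖} = Complex.exp '' {w | Real.log r < w.re} := by
    ext z
    constructor
    · intro hz
      have hz' : r < ‖z‖ := hz
      have h0 : z ≠ 0 := norm_pos_iff.1 (hr.trans hz')
      exact ⟨Complex.log z, by simpa [Complex.log_re] using Real.log_lt_log hr hz',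
        Complex.exp_log h0⟩
    · rintro ⟨w, hw, rfl⟩
      simpa [Complex.norm_exp] using (Real.log_lt_iff_lt_exp hr).1 hw
  rw [this]
  exact (convex_halfSpace_re_gt _).isPreconnected.image _ Complex.continuous_exp.continuousOn

/-- At most one component of the complement of a compact set is unbounded. -/
lemma isBounded_component {K : Set ℂ} (hK : IsCompact K) {p q : ℂ}
    (hpq : q ∉ connectedComponentIn Kᶜ p) (hq : q ∈ Kᶜ) :
    Bornology.IsBounded (connectedComponentIn Kᶜ p) ∨
      Bornology.IsBounded (connectedComponentIn Kᶜ q) := by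
  obtain ⟨r, hr, hKr⟩ := hK.isBounded.subset_closedBall_lt 0 0
  have hsub : {z : ℂ | r < ‖z‖} ⊆ Kᶜ := fun z hz hzK => by
    have := hKr hzK
    simp only [mem_closedBall, dist_zero_right] at this
    exact absurd hz (not_lt.2 this)
  -- Every unbounded component contains the connected exterior of a disc around `K`, so two
  -- unbounded ones would coincide.
  have key : ∀ x, ¬ Bornology.IsBounded (connectedComponentIn Kᶜ x) →
      {z : ℂ | r < ‖z‖} ⊆ connectedComponentIn Kᶜ x := by
    intro x hx
    have : ∃ z ∈ connectedComponentIn Kᶜ x, r < ‖z‖ := by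
      by_contra! h
      exact hx ((isBounded_closedBall (x := (0 : ℂ)) (r := r)).subset fun z hz => by
        simpa using h z hz)
    obtain ⟨z, hz, hzr⟩ := this
    rw [connectedComponentIn_eq hz]
    exact (isPreconnected_lt_norm hr).subset_connectedComponentIn hzr hsub
  by_contra! h
  have hp := key p h.1
  have hq' := key q h.2
  have hw : r < ‖((r + 1 : ℝ) : ℂ)‖ := by
    rw [Complex.norm_real]
    exact (lt_add_one r).trans_le (le_abs_self _)
  have h1 := connectedComponentIn_eq (hp hw)
  have h2 := connectedComponentIn_eq (hq' hw)
  exact hpq (h1.trans h2.symm ▸ mem_connectedComponentIn hq)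

/-- Components of an open set are open, so a limit point outside `K` lies in a component that meets
the given one. -/
lemma frontier_component_subset {K : Set ℂ} (hK : IsClosed K) (p : ℂ) :
    closure (connectedComponentIn Kᶜ p) ⊆ connectedComponentIn Kᶜ p ∪ K := by
  intro x hx
  by_cases hxK : x ∈ K
  · exact Or.inr hxK
  left
  have ho := hK.isOpen_compl.connectedComponentIn (x := x)
  obtain ⟨y, hy, hyp⟩ := mem_closure_iff.1 hx _ ho (mem_connectedComponentIn hxK)
  rw [connectedComponentIn_eq hyp, ← connectedComponentIn_eq hy]
  exact mem_connectedComponentIn hxK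

/-- A power of `z - p` times a function without zeros on a bounded component containing `p` has
no logarithm on the boundary. -/
lemma not_hasLogOn_of_isBounded {K : Set ℂ} (hK : IsCompact K) {p : ℂ} (hp : p ∉ K)
    (hb : Bornology.IsBounded (connectedComponentIn Kᶜ p)) {k : ℤ} (hk : k ≠ 0) {r : ℂ → ℂ}
    (hr : ContinuousOn r (connectedComponentIn Kᶜ p ∪ K))
    (hr0 : ∀ z ∈ connectedComponentIn Kᶜ p ∪ K, r z ≠ 0) :
    ¬ HasLogOn (fun z => (z - p) ^ k * r z) K := by
  classical
  intro h
  obtain ⟨g, hg⟩ := hasLogOn_iff_exists_subtype.1 h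
  -- Tietze extends the logarithm from `K` to the whole plane.
  obtain ⟨G, hG⟩ := ContinuousMap.exists_restrict_eq hK.isClosed g
  have hGK : ∀ z ∈ K, Complex.exp (G z) = (z - p) ^ k * r z := fun z hz => by
    rw [← hg ⟨z, hz⟩, ← hG]; rfl
  set U := connectedComponentIn Kᶜ p with hU
  have hUK : ∀ z ∈ U, z ∉ K := connectedComponentIn_subset _ _
  have hUo : IsOpen U := hK.isClosed.isOpen_compl.connectedComponentIn
  have hpU : p ∈ U := mem_connectedComponentIn hp
  have hcl : IsClosed (U ∪ K) := by
    rw [← closure_subset_iff_isClosed, closure_union, hK.isClosed.closure_eq]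
    exact union_subset (frontier_component_subset hK.isClosed p) subset_union_right
  -- On `U` the zero or pole of `(z - p) ^ k` is replaced by `exp G / r`, which agrees with it on
  -- `K`. The result is continuous without zeros on `ℂ`, so it has a logarithm; on a large circle
  -- around `p` it is still `(z - p) ^ k`.
  let F : ℂ → ℂ := fun z => if z ∈ U then Complex.exp (G z) / r z else (z - p) ^ k
  have e1 : EqOn F (fun z => Complex.exp (G z) / r z) (U ∪ K) := by
    rintro z (hz | hz)
    · simp [F, hz]
    · have hzU : z ∉ U := fun h => hUK z h hz
      simp only [F, hzU, if_false]
      rw [hGK z hz, mul_div_cancel_right₀ _ (hr0 z (Or.inr hz))]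
  have e2 : EqOn F (fun z => (z - p) ^ k) Uᶜ := fun z hz => by
    have : z ∉ U := hz
    simp [F, this]
  have c1 : ContinuousOn F (U ∪ K) :=
    (ContinuousOn.div (by fun_prop) hr hr0).congr e1
  have hne : ∀ z ∈ Uᶜ, z - p ≠ 0 := fun z hz h => hz (by rwa [sub_eq_zero.1 h])
  have c2 : ContinuousOn F Uᶜ :=
    (ContinuousOn.zpow₀ (by fun_prop) k fun z hz => Or.inl (hne z hz)).congr e2
  have hF : Continuous F := by
    rw [← continuousOn_univ]
    refine (c1.union_of_isClosed c2 hcl hUo.isClosed_compl).mono fun z _ => ?_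
    by_cases hz : z ∈ U
    · exact Or.inl (Or.inl hz)
    · exact Or.inr hz
  have hF0 : ∀ z, F z ≠ 0 := fun z => by
    by_cases hz : z ∈ U
    · rw [e1 (Or.inl hz)]
      exact div_ne_zero (Complex.exp_ne_zero _) (hr0 z (Or.inl hz))
    · rw [e2 hz]
      exact zpow_ne_zero _ (hne z hz)
  obtain ⟨R, hR, hUR⟩ := hb.subset_ball_lt 0 p
  refine not_hasLogOn_sphere p hR hk (((hasLogOn_univ hF hF0).mono (subset_univ _)).congr ?_)
  intro z hz
  refine e2 fun hzU => ?_
  have h1 := hUR hzU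
  rw [mem_ball] at h1
  rw [mem_sphere] at hz
  exact absurd hz h1.ne

/-- Points in the complement of `K` are separated by `K` if they are in different components. -/
lemma not_hasLogOn_of_separated {K : Set ℂ} (hK : IsCompact K) {p q s : ℂ}
    (hp : p ∉ K) (hq : q ∉ K) (hs : s ∉ K) (hpq : q ∉ connectedComponentIn Kᶜ p)
    (hps : s ∉ connectedComponentIn Kᶜ p) (hqs : s ∉ connectedComponentIn Kᶜ q)
    {k l : ℤ} (hk : k ≠ 0) (hl : l ≠ 0) (m : ℤ) :
    ¬ HasLogOn (fun z => (z - p) ^ k * ((z - q) ^ l * (z - s) ^ m)) K := by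
  have hqp : p ∉ connectedComponentIn Kᶜ q := fun h => hpq (by
    rw [← connectedComponentIn_eq h]; exact mem_connectedComponentIn hq)
  have main : ∀ {a b : ℂ} {i j : ℤ}, a ∉ K → b ∉ K → b ∉ connectedComponentIn Kᶜ a →
      s ∉ connectedComponentIn Kᶜ a → Bornology.IsBounded (connectedComponentIn Kᶜ a) → i ≠ 0 →
      ¬ HasLogOn (fun z => (z - a) ^ i * ((z - b) ^ j * (z - s) ^ m)) K := by
    intro a b i j ha hb hab has hbd hi
    have hne : ∀ c, c ∉ K → c ∉ connectedComponentIn Kᶜ a →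
        ∀ z ∈ connectedComponentIn Kᶜ a ∪ K, z - c ≠ 0 := by
      intro c hc hca z hz h
      rw [sub_eq_zero.1 h] at hz
      exact hz.elim hca hc
    refine not_hasLogOn_of_isBounded hK ha hbd hi (r := fun z => (z - b) ^ j * (z - s) ^ m) ?_ ?_
    · exact (ContinuousOn.zpow₀ (by fun_prop) _ fun z hz => Or.inl (hne b hb hab z hz)).mul
        (ContinuousOn.zpow₀ (by fun_prop) _ fun z hz => Or.inl (hne s hs has z hz))
    · exact fun z hz => mul_ne_zero (zpow_ne_zero _ (hne b hb hab z hz))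
        (zpow_ne_zero _ (hne s hs has z hz))
  -- One of the components of `p` and `q` is bounded; the factors belonging to the other two points
  -- have no zeros or poles there.
  rcases isBounded_component hK hpq hq with h | h
  · exact main hp hq hpq hps h hk
  · intro hlog
    refine main (j := k) hq hp hqp hqs h hl (hlog.congr fun z _ => ?_)
    simp only
    ring

lemma joinedIn_of_mem_component {K : Set ℂ} (hK : IsClosed K) {p q : ℂ} (hp : p ∉ K)
    (hq : q ∈ connectedComponentIn Kᶜ p) : JoinedIn Kᶜ p q := by
  have ho : IsOpen (connectedComponentIn Kᶜ p) := hK.isOpen_compl.connectedComponentIn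
  have hc : IsConnected (connectedComponentIn Kᶜ p) := isConnected_connectedComponentIn_iff.2 hp
  exact ((ho.isConnected_iff_isPathConnected.1 hc).joinedIn p (mem_connectedComponentIn hp) q
    hq).mono (connectedComponentIn_subset _ _)

lemma hasLogOn_of_mem_component {K : Set ℂ} (hK : IsClosed K) {p q : ℂ} (hp : p ∉ K)
    (hq : q ∈ connectedComponentIn Kᶜ p) : HasLogOn (fun z => (z - p) / (z - q)) K :=
  let h := joinedIn_of_mem_component hK hp hq
  hasLogOn_div_of_path h.somePath fun t => h.somePath_mem t

/-- Points outside `K` whose quotient has a logarithm on `K` are in the same component. -/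
lemma mem_component_of_hasLogOn {K : Set ℂ} (hK : IsCompact K) {p q : ℂ} (hp : p ∉ K)
    (hq : q ∉ K) (h : HasLogOn (fun z => (z - p) / (z - q)) K) :
    q ∈ connectedComponentIn Kᶜ p := by
  by_contra hpq
  have hqp : p ∉ connectedComponentIn Kᶜ q := fun h => hpq (by
    rw [← connectedComponentIn_eq h]; exact mem_connectedComponentIn hq)
  have main : ∀ {a b : ℂ}, a ∉ K → b ∉ K → b ∉ connectedComponentIn Kᶜ a →
      Bornology.IsBounded (connectedComponentIn Kᶜ a) →
      ¬ HasLogOn (fun z => (z - a) / (z - b)) K := by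
    intro a b ha hb hab hbd hlog
    have hne : ∀ z ∈ connectedComponentIn Kᶜ a ∪ K, z - b ≠ 0 := by
      intro z hz h
      rw [sub_eq_zero.1 h] at hz
      exact hz.elim hab hb
    refine not_hasLogOn_of_isBounded hK ha hbd one_ne_zero (r := fun z => (z - b)⁻¹)
      (ContinuousOn.inv₀ (by fun_prop) hne) (fun z hz => inv_ne_zero (hne z hz))
      (hlog.congr fun z _ => by simp [div_eq_mul_inv])
  rcases isBounded_component hK hpq hq with hb | hb
  · exact main hp hq hpq hb h
  · exact main hq hp hqp hb ((h.zpow (-1)).congr fun z _ => by simp)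

/-! ### How an added arc changes the components: it splits one into at least two and at most two. -/

/-- Adding an arc between two points that are joined in `K` separates the component of the
complement of `K` that contains the arc. -/
lemma exists_separated_of_arc {K A : Set ℂ} (hK : IsClosed K) (hA : IsClosed A) {a b x : ℂ}
    (hab : a ≠ b) (jK : JoinedIn K a b) (jA : JoinedIn A a b)
    (hAW : A \ {a, b} ⊆ connectedComponentIn Kᶜ x) :
    ∃ p ∈ connectedComponentIn Kᶜ x \ A, ∃ q ∈ connectedComponentIn Kᶜ x \ A,
      q ∉ connectedComponentIn (K ∪ A)ᶜ p := by
  classical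
  by_contra! hcon
  set W := connectedComponentIn Kᶜ x with hW
  have hWK : W ⊆ Kᶜ := connectedComponentIn_subset _ _
  have hWo : IsOpen W := hK.isOpen_compl.connectedComponentIn
  -- Moving `a` to `b` along `A` gives a logarithm of `(z - a) / (z - b)` off `A`; moving it along
  -- `K` gives one off `K`. If `W \ A` lies in one component of the complement of `K ∪ A`, they
  -- differ there by a constant and glue to a logarithm on `W ∪ Aᶜ`.
  obtain ⟨g, hg, eg⟩ := hasLogOn_div_of_path (Z := Aᶜ) jA.somePath
    fun t h => h (jA.somePath_mem t)
  obtain ⟨h, hh, eh⟩ := hasLogOn_div_of_path (Z := Kᶜ) jK.somePath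
    fun t h => h (jK.somePath_mem t)
  have hn : ∃ n : ℤ, ∀ z ∈ W \ A, g z = h z + n * (2 * Real.pi * Complex.I) := by
    rcases (W \ A).eq_empty_or_nonempty with he | ⟨p, hp⟩
    · exact ⟨0, by simp [he]⟩
    have hC : connectedComponentIn (K ∪ A)ᶜ p ⊆ (K ∪ A)ᶜ := connectedComponentIn_subset _ _
    rw [compl_union] at hC
    obtain ⟨n, hn⟩ := log_sub_log_const
      (isPreconnected_connectedComponentIn (x := p) (F := (K ∪ A)ᶜ))
      (hg.mono fun z hz => (hC (by rwa [compl_union] at hz)).2)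
      (hh.mono fun z hz => (hC (by rwa [compl_union] at hz)).1)
      (fun z hz => eg z (hC (by rwa [compl_union] at hz)).2)
      (fun z hz => eh z (hC (by rwa [compl_union] at hz)).1)
    exact ⟨n, fun z hz => hn z (hcon p hp z hz)⟩
  obtain ⟨n, hn⟩ := hn
  let G : ℂ → ℂ := fun z => if z ∈ A then h z + n * (2 * Real.pi * Complex.I) else g z
  have eW : EqOn G (fun z => h z + n * (2 * Real.pi * Complex.I)) W := fun z hz => by
    by_cases hzA : z ∈ A
    · simp [G, hzA]
    · simp [G, hzA, hn z ⟨hz, hzA⟩]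
  have eA : EqOn G g Aᶜ := fun z hz => by
    have : z ∉ A := hz
    simp [G, this]
  have cW : ContinuousOn G W := ((hh.mono hWK).add continuousOn_const).congr eW
  have cA : ContinuousOn G Aᶜ := hg.congr eA
  have hlog : HasLogOn (fun z => (z - a) / (z - b)) (W ∪ Aᶜ) := by
    refine ⟨G, cW.union_of_isOpen cA hWo hA.isOpen_compl, ?_⟩
    rintro z (hz | hz)
    · rw [eW hz]
      simp only
      rw [Complex.exp_add, eh z (hWK hz), Complex.exp_int_mul_two_pi_mul_I, mul_one]
    · rw [eA hz, eg z hz]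
  -- With half the distance as radius, the circle around `a` avoids both ends, hence lies in `W ∪
  -- Aᶜ`. As `b` is outside it, `z - b` has a logarithm on it, and then so would `z - a`.
  set r : ℝ := ‖b - a‖ / 2 with hr
  have hr0 : 0 < r := by
    have := norm_pos_iff.2 (sub_ne_zero.2 hab.symm)
    positivity
  have hda : dist b a = 2 * r := by rw [dist_eq_norm]; linarith
  have hsub : sphere a r ⊆ W ∪ Aᶜ := by
    intro z hz
    by_cases hzA : z ∈ A
    · refine Or.inl (hAW ⟨hzA, ?_⟩)
      rintro (rfl | rfl)
      · simp at hz; exact hr0.ne hz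
      · rw [mem_sphere, hda] at hz; linarith
    · exact Or.inr hzA
  have hb : HasLogOn (fun z => z - b) (sphere a r) := by
    have hne : ∀ z ∈ sphere a r, (z - b) / (a - b) ∈ Complex.slitPlane := by
      intro z hz
      have hz' : ‖(z - b) / (a - b) - 1‖ < 1 := by
        have hab' : a - b ≠ 0 := sub_ne_zero.2 hab
        have : (z - b) / (a - b) - 1 = (z - a) / (a - b) := by field_simp; ring
        rw [this, norm_div, div_lt_one (norm_pos_iff.2 hab'), norm_sub_rev a b]
        rw [mem_sphere, dist_eq_norm] at hz
        rw [hz, hr]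
        have := norm_pos_iff.2 (sub_ne_zero.2 hab.symm)
        linarith
      refine Or.inl ?_
      have h1 := (abs_lt.1 ((Complex.abs_re_le_norm _).trans_lt hz')).1
      simp only [Complex.sub_re, Complex.one_re] at h1
      linarith
    refine ⟨fun z => Complex.log ((z - b) / (a - b)) + Complex.log (a - b),
      ContinuousOn.add (ContinuousOn.clog (by fun_prop) hne) continuousOn_const,
      fun z hz => ?_⟩
    have h1 := Complex.slitPlane_ne_zero (hne z hz)
    have h2 : a - b ≠ 0 := sub_ne_zero.2 hab
    simp only [Complex.exp_add, Complex.exp_log h1, Complex.exp_log h2]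
    field_simp
  refine not_hasLogOn_sphere a hr0 one_ne_zero (((hlog.mono hsub).mul hb).congr fun z hz => ?_)
  have : z - b ≠ 0 := by
    intro h
    rw [sub_eq_zero.1 h, mem_sphere, hda] at hz
    linarith
  simp only [zpow_one]
  field_simp

/-- Logarithms of the same function on a set and on an arc with ends in that set differ by
multiples of `2πi` at the ends. -/
lemma exists_defect {K : Set ℂ} (α : C(unitInterval, ℂ)) (h0 : α 0 ∈ K) (h1 : α 1 ∈ K)
    {f g h : ℂ → ℂ} (eg : ∀ z ∈ K, Complex.exp (g z) = f z)
    (eh : ∀ z ∈ range α, Complex.exp (h z) = f z) :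
    ∃ i j : ℤ, h (α 0) = g (α 0) + i * (2 * Real.pi * Complex.I) ∧
      h (α 1) = g (α 1) + j * (2 * Real.pi * Complex.I) := by
  obtain ⟨i, hi⟩ := Complex.exp_eq_exp_iff_exists_int.1
    ((eh _ (mem_range_self 0)).trans (eg _ h0).symm)
  obtain ⟨j, hj⟩ := Complex.exp_eq_exp_iff_exists_int.1
    ((eh _ (mem_range_self 1)).trans (eg _ h1).symm)
  exact ⟨i, j, hi, hj⟩

lemma unitInterval_eq_zero_or_one_or_mem_Ioo (t : unitInterval) :
    t = 0 ∨ t = 1 ∨ t ∈ Ioo (0 : unitInterval) 1 := by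
  rcases eq_or_lt_of_le (unitInterval.nonneg' (t := t)) with h | h
  · exact Or.inl h.symm
  rcases eq_or_lt_of_le (unitInterval.le_one' (t := t)) with h' | h'
  · exact Or.inr (Or.inl h')
  · exact Or.inr (Or.inr ⟨h, h'⟩)

/-- An arc whose interior avoids `K` does not split a component of the complement of `K` into
three. -/
lemma mem_component_or_of_arc {K : Set ℂ} (hK : IsCompact K) (α : C(unitInterval, ℂ))
    (hα : Function.Injective α) (h0 : α 0 ∈ K) (h1 : α 1 ∈ K)
    (hαK : ∀ t ∈ Ioo (0 : unitInterval) 1, α t ∉ K) {x p q s : ℂ}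
    (hp : p ∈ connectedComponentIn Kᶜ x) (hq : q ∈ connectedComponentIn Kᶜ x)
    (hs : s ∈ connectedComponentIn Kᶜ x) (hpA : p ∉ range α) (hqA : q ∉ range α)
    (hsA : s ∉ range α) :
    q ∈ connectedComponentIn (K ∪ range α)ᶜ p ∨ s ∈ connectedComponentIn (K ∪ range α)ᶜ p ∨
      s ∈ connectedComponentIn (K ∪ range α)ᶜ q := by
  have hKc : ∀ z ∈ connectedComponentIn Kᶜ x, z ∉ K := connectedComponentIn_subset _ _
  have hA : IsCompact (range α) := isCompact_range α.continuous
  have hKA := hK.union hA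
  have hn : ∀ {z}, z ∈ connectedComponentIn Kᶜ x → z ∉ range α → z ∉ K ∪ range α :=
    fun hz hz' h => h.elim (hKc _ hz) hz'
  have hlog : ∀ u ∈ connectedComponentIn Kᶜ x, u ∉ range α →
      ∃ g h : ℂ → ℂ, ContinuousOn g K ∧ ContinuousOn h (range α) ∧
        (∀ z ∈ K, Complex.exp (g z) = (z - u) / (z - s)) ∧
        (∀ z ∈ range α, Complex.exp (h z) = (z - u) / (z - s)) := by
    intro u hu huA
    obtain ⟨g, hg, eg⟩ := hasLogOn_of_mem_component hK.isClosed (hKc u hu)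
      (connectedComponentIn_eq hu ▸ hs)
    have hne : ∀ {w}, w ∉ range α → ∀ z ∈ range α, z - w ≠ 0 := fun hw z hz h =>
      hw (by rwa [← sub_eq_zero.1 h])
    obtain ⟨h, hh, eh⟩ := hasLogOn_arc (f := fun z => (z - u) / (z - s)) α hα
      (ContinuousOn.div (by fun_prop) (by fun_prop) (hne hsA))
      (fun z hz => div_ne_zero (hne huA z hz) (hne hsA z hz))
    exact ⟨g, h, hg, hh, eg, eh⟩
  -- The arc meets `K` only at its ends. If the discrepancy is the same at both, a constant shift of
  -- `g` makes the logarithms agree.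
  have glue : ∀ {f g h : ℂ → ℂ}, ContinuousOn g K → ContinuousOn h (range α) →
      (∀ z ∈ K, Complex.exp (g z) = f z) → (∀ z ∈ range α, Complex.exp (h z) = f z) →
      h (α 0) - g (α 0) = h (α 1) - g (α 1) → HasLogOn f (K ∪ range α) := by
    intro f g h hg hh eg eh hd
    obtain ⟨i, j, hi, hj⟩ := exists_defect α h0 h1 eg eh
    refine hasLogOn_union (g := fun z => g z + i * (2 * Real.pi * Complex.I)) hK.isClosed
      hA.isClosed (hg.add continuousOn_const) hh (fun z hz => ?_) eh ?_
    · rw [Complex.exp_add, eg z hz, Complex.exp_int_mul_two_pi_mul_I, mul_one]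
    · rintro _ hz ⟨t, rfl⟩
      rcases unitInterval_eq_zero_or_one_or_mem_Ioo t with rfl | rfl | ht
      · exact hi.symm
      · linear_combination hd - hi
      · exact absurd hz (hαK t ht)
  obtain ⟨g₁, h₁, cg₁, ch₁, eg₁, eh₁⟩ := hlog p hp hpA
  obtain ⟨g₂, h₂, cg₂, ch₂, eg₂, eh₂⟩ := hlog q hq hqA
  obtain ⟨i₁, j₁, hi₁, hj₁⟩ := exists_defect α h0 h1 eg₁ eh₁
  obtain ⟨i₂, j₂, hi₂, hj₂⟩ := exists_defect α h0 h1 eg₂ eh₂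
  by_cases d₁ : i₁ = j₁
  · refine Or.inr (Or.inl (mem_component_of_hasLogOn hKA (hn hp hpA) (hn hs hsA)
      (glue cg₁ ch₁ eg₁ eh₁ ?_)))
    rw [hi₁, hj₁, d₁]; ring
  by_cases d₂ : i₂ = j₂
  · refine Or.inr (Or.inr (mem_component_of_hasLogOn hKA (hn hq hqA) (hn hs hsA)
      (glue cg₂ ch₂ eg₂ eh₂ ?_)))
    rw [hi₂, hj₂, d₂]; ring
  by_contra! hcon
  -- With nonzero defects `d₁ = i₁ - j₁` and `d₂ = i₂ - j₂`, the exponents `d₂` and `-d₁` on the two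
  -- quotients cancel the total defect. The product then has a logarithm on `K ∪ range α`, which
  -- three distinct components forbid.
  refine not_hasLogOn_of_separated hKA (hn hp hpA) (hn hq hqA) (hn hs hsA) hcon.1 hcon.2.1
    hcon.2.2 (sub_ne_zero.2 d₂) (neg_ne_zero.2 (sub_ne_zero.2 d₁)) (-((i₂ - j₂) - (i₁ - j₁))) ?_
  have := glue (f := fun z => ((z - p) / (z - s)) ^ (i₂ - j₂) *
      ((z - q) / (z - s)) ^ (-(i₁ - j₁)))
    (g := fun z => ((i₂ - j₂ : ℤ) : ℂ) * g₁ z + ((-(i₁ - j₁) : ℤ) : ℂ) * g₂ z)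
    (h := fun z => ((i₂ - j₂ : ℤ) : ℂ) * h₁ z + ((-(i₁ - j₁) : ℤ) : ℂ) * h₂ z)
    ((continuousOn_const.mul cg₁).add (continuousOn_const.mul cg₂))
    ((continuousOn_const.mul ch₁).add (continuousOn_const.mul ch₂))
    (fun z hz => by simp only [Complex.exp_add, Complex.exp_int_mul, eg₁ z hz, eg₂ z hz])
    (fun z hz => by simp only [Complex.exp_add, Complex.exp_int_mul, eh₁ z hz, eh₂ z hz])
    (by simp only [hi₁, hj₁, hi₂, hj₂]; push_cast; ring)
  refine this.congr fun z hz => ?_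
  have hzs : z - s ≠ 0 := fun h => hn hs hsA (by rwa [← sub_eq_zero.1 h])
  have e : -((i₂ - j₂) - (i₁ - j₁)) = -(i₂ - j₂) + (-(-(i₁ - j₁))) := by ring
  simp only
  rw [e, zpow_add₀ hzs, div_zpow, div_zpow, zpow_neg (z - s) (i₂ - j₂),
    zpow_neg (z - s) (-(i₁ - j₁))]
  ring

/-! ### Drawings as compact subsets of `ℂ`. -/

namespace SimpleGraph.PlaneDrawing

variable {V : Type*} {G : SimpleGraph V} (D : G.PlaneDrawing)

/-- The position of a vertex as a complex number. -/
noncomputable def pt (v : V) : ℂ := Complex.orthonormalBasisOneI.repr.symm (D.point v)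

/-- The arc of an edge in the complex plane. -/
noncomputable def curve (e : G.edgeSet) : C(unitInterval, ℂ) :=
  ⟨fun t => Complex.orthonormalBasisOneI.repr.symm (D.arc e t),
    Complex.orthonormalBasisOneI.repr.symm.continuous.comp (D.arc e).continuous⟩

/-- The part of the drawing given by a set of vertices and a set of edges. -/
def carrier (P : Set V) (E : Set G.edgeSet) : Set ℂ :=
  D.pt '' P ∪ ⋃ e ∈ E, range (D.curve e)

/-- The edges of `G` that belong to `H`. -/
def edgesIn (G H : SimpleGraph V) : Set G.edgeSet := {e | (e : Sym2 V) ∈ H.edgeSet}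

/-- The drawing of all vertices and of the edges in `H`. -/
def picture (H : SimpleGraph V) : Set ℂ := D.carrier univ (edgesIn G H)

lemma pt_injective : Function.Injective D.pt :=
  Complex.orthonormalBasisOneI.repr.symm.injective.comp D.point_injective

lemma curve_injective (e : G.edgeSet) : Function.Injective (D.curve e) :=
  Complex.orthonormalBasisOneI.repr.symm.injective.comp (D.arc_injective e)

lemma exists_ends (e : G.edgeSet) :
    ∃ u v, (e : Sym2 V) = s(u, v) ∧ D.curve e 0 = D.pt u ∧ D.curve e 1 = D.pt v := by
  have h := D.arc_ends e
  obtain ⟨e, he⟩ := e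
  induction e using Sym2.ind with
  | _ x y =>
    simp only [Sym2.map_mk, Sym2.eq_iff] at h
    rcases h with ⟨h0, h1⟩ | ⟨h0, h1⟩
    · exact ⟨x, y, rfl, by simp [curve, pt, h0], by simp [curve, pt, h1]⟩
    · exact ⟨y, x, Sym2.eq_swap, by simp [curve, pt, h0], by simp [curve, pt, h1]⟩

lemma curve_ne_pt (e : G.edgeSet) {t : unitInterval} (ht : t ∈ Ioo (0 : unitInterval) 1) (v : V) :
    D.curve e t ≠ D.pt v := fun h =>
  D.arc_ne_point e t ht v (Complex.orthonormalBasisOneI.repr.symm.injective h)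

lemma curve_ne_curve {e f : G.edgeSet} (hef : e ≠ f) {s t : unitInterval}
    (hs : s ∈ Ioo (0 : unitInterval) 1) (ht : t ∈ Ioo (0 : unitInterval) 1) :
    D.curve e s ≠ D.curve f t := fun h =>
  D.arc_ne_arc e f hef s hs t ht (Complex.orthonormalBasisOneI.repr.symm.injective h)

lemma exists_of_mem_carrier {P : Set V} {E : Set G.edgeSet} (hE : ∀ e ∈ E, ∀ v ∈ e.1, v ∈ P)
    {z : ℂ} (hz : z ∈ D.carrier P E) :
    (∃ v ∈ P, z = D.pt v) ∨ ∃ e ∈ E, ∃ t ∈ Ioo (0 : unitInterval) 1, z = D.curve e t := by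
  rcases hz with ⟨v, hv, rfl⟩ | hz
  · exact Or.inl ⟨v, hv, rfl⟩
  simp only [mem_iUnion, mem_range] at hz
  obtain ⟨e, he, t, rfl⟩ := hz
  obtain ⟨u, v, huv, h0, h1⟩ := D.exists_ends e
  rcases unitInterval_eq_zero_or_one_or_mem_Ioo t with rfl | rfl | ht
  · exact Or.inl ⟨u, hE e he u (by simp [huv]), h0⟩
  · exact Or.inl ⟨v, hE e he v (by simp [huv]), h1⟩
  · exact Or.inr ⟨e, he, t, ht, rfl⟩

lemma exists_of_mem_picture {H : SimpleGraph V} {z : ℂ} (hz : z ∈ D.picture H) :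
    (∃ v, z = D.pt v) ∨ ∃ e ∈ edgesIn G H, ∃ t ∈ Ioo (0 : unitInterval) 1, z = D.curve e t := by
  simpa using D.exists_of_mem_carrier (fun _ _ _ _ => mem_univ _) hz

lemma pt_mem_picture (H : SimpleGraph V) (v : V) : D.pt v ∈ D.picture H :=
  Or.inl ⟨v, mem_univ _, rfl⟩

lemma curve_mem_carrier {P : Set V} {E : Set G.edgeSet} {e : G.edgeSet} (he : e ∈ E)
    (t : unitInterval) : D.curve e t ∈ D.carrier P E := by
  refine Or.inr ?_
  simp only [mem_iUnion]
  exact ⟨e, he, t, rfl⟩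

lemma curve_ends_mem_picture (e : G.edgeSet) (H : SimpleGraph V) :
    D.curve e 0 ∈ D.picture H ∧ D.curve e 1 ∈ D.picture H := by
  obtain ⟨u, v, -, h0, h1⟩ := D.exists_ends e
  rw [h0, h1]
  exact ⟨D.pt_mem_picture H u, D.pt_mem_picture H v⟩

lemma curve_notMem_picture {H : SimpleGraph V} {e : G.edgeSet} (he : e ∉ edgesIn G H)
    {t : unitInterval} (ht : t ∈ Ioo (0 : unitInterval) 1) : D.curve e t ∉ D.picture H := by
  intro h
  rcases D.exists_of_mem_picture h with ⟨v, hv⟩ | ⟨f, hf, s, hs, hfs⟩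
  · exact D.curve_ne_pt e ht v hv
  · exact D.curve_ne_curve (by rintro rfl; exact he hf) ht hs hfs

lemma carrier_mono {P Q : Set V} {E F : Set G.edgeSet} (hP : P ⊆ Q) (hE : E ⊆ F) :
    D.carrier P E ⊆ D.carrier Q F :=
  union_subset_union (image_mono hP) (biUnion_subset_biUnion_left hE)

lemma picture_mono {H H' : SimpleGraph V} (h : H ≤ H') : D.picture H ⊆ D.picture H' :=
  D.carrier_mono le_rfl fun _ he => edgeSet_mono h he

lemma isCompact_carrier [Finite V] (P : Set V) (E : Set G.edgeSet) :
    IsCompact (D.carrier P E) :=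
  ((Set.toFinite P).image _).isCompact.union
    ((Set.toFinite E).isCompact_biUnion fun e _ => isCompact_range (D.curve e).continuous)

lemma isCompact_picture [Finite V] (H : SimpleGraph V) : IsCompact (D.picture H) :=
  D.isCompact_carrier _ _

lemma picture_eq_union {H : SimpleGraph V} {e : G.edgeSet} (he : e ∈ edgesIn G H) :
    D.picture H = D.picture (H.deleteEdges {e.1}) ∪ range (D.curve e) := by
  apply Subset.antisymm
  · intro z hz
    rcases D.exists_of_mem_picture hz with ⟨v, rfl⟩ | ⟨f, hf, t, -, rfl⟩
    · exact Or.inl (D.pt_mem_picture _ v)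
    · by_cases hfe : f = e
      · subst hfe
        exact Or.inr (mem_range_self t)
      · refine Or.inl (D.curve_mem_carrier ?_ t)
        simp only [edgesIn, edgeSet_deleteEdges, mem_ofPred_eq, mem_sdiff, mem_singleton_iff]
        exact ⟨hf, fun h => hfe (Subtype.ext h)⟩
  · refine union_subset (D.picture_mono (deleteEdges_le _)) ?_
    rintro _ ⟨t, rfl⟩
    exact D.curve_mem_carrier he t

lemma notMem_edgesIn_deleteEdges (H : SimpleGraph V) (e : G.edgeSet) :
    e ∉ edgesIn G (H.deleteEdges {e.1}) := by
  simp [edgesIn, edgeSet_deleteEdges]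

lemma joinedIn_curve (e : G.edgeSet) :
    JoinedIn (range (D.curve e)) (D.curve e 0) (D.curve e 1) :=
  ⟨⟨D.curve e, rfl, rfl⟩, fun t => mem_range_self t⟩

lemma joinedIn_picture {H : SimpleGraph V} (hH : H ≤ G) {u v : V} (h : H.Reachable u v) :
    JoinedIn (D.picture H) (D.pt u) (D.pt v) := by
  obtain ⟨w⟩ := h
  induction w with
  | nil => exact JoinedIn.refl (D.pt_mem_picture _ _)
  | @cons u v w huv _ ih =>
    refine JoinedIn.trans ?_ ih
    have hsub : range (D.curve ⟨s(u, v), hH huv⟩) ⊆ D.picture H := by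
      rintro _ ⟨t, rfl⟩
      exact D.curve_mem_carrier (show _ ∈ edgesIn G H from huv) t
    obtain ⟨a, b, hab, h0, h1⟩ := D.exists_ends ⟨s(u, v), hH huv⟩
    have hj := (D.joinedIn_curve ⟨s(u, v), hH huv⟩).mono hsub
    rw [h0, h1] at hj
    rcases Sym2.eq_iff.1 hab with ⟨rfl, rfl⟩ | ⟨rfl, rfl⟩
    · exact hj
    · exact hj.symm

lemma disjoint_carrier {P Q : Set V} {E F : Set G.edgeSet} (hE : ∀ e ∈ E, ∀ v ∈ e.1, v ∈ P)
    (hF : ∀ e ∈ F, ∀ v ∈ e.1, v ∈ Q) (hPQ : Disjoint P Q) :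
    Disjoint (D.carrier P E) (D.carrier Q F) := by
  rw [Set.disjoint_left] at hPQ ⊢
  intro z hz hz'
  rcases D.exists_of_mem_carrier hE hz with ⟨v, hv, rfl⟩ | ⟨e, he, t, ht, rfl⟩ <;>
  rcases D.exists_of_mem_carrier hF hz' with ⟨w, hw, hvw⟩ | ⟨f, hf, s, hs, hfs⟩
  · exact hPQ hv (D.pt_injective hvw ▸ hw)
  · exact D.curve_ne_pt f hs v hfs.symm
  · exact D.curve_ne_pt e ht w hvw
  · by_cases hef : e = f
    · subst hef
      obtain ⟨u, v, huv, -, -⟩ := D.exists_ends e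
      have hu : u ∈ e.1 := by simp [huv]
      exact hPQ (hE e he u hu) (hF e hf u hu)
    · exact D.curve_ne_curve hef ht hs hfs

/-! ### Drawings of forests. -/

/-- A nowhere vanishing continuous function on the drawing of a forest has a logarithm. -/
lemma hasLogOn_picture_of_isAcyclic [Finite V] {f : ℂ → ℂ} (n : ℕ) :
    ∀ H : SimpleGraph V, H.IsAcyclic → (edgesIn G H).ncard = n →
      ContinuousOn f (D.picture H) → (∀ z ∈ D.picture H, f z ≠ 0) →
      HasLogOn f (D.picture H) := by
  classical
  induction n with
  | zero =>
    intro H _ hcard _ h0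
    rw [Set.ncard_eq_zero] at hcard
    have hfin : (D.picture H).Finite := by
      rw [picture, carrier, hcard]
      simpa using Set.finite_range D.pt
    exact ⟨fun z => Complex.log (f z), hfin.continuousOn _, fun z hz =>
      Complex.exp_log (h0 z hz)⟩
  | succ n ih =>
    intro H hH hcard hf h0
    obtain ⟨e, he⟩ : (edgesIn G H).Nonempty := by
      rw [← Set.ncard_pos, hcard]
      exact n.succ_pos
    set H' := H.deleteEdges {e.1} with hH'
    have hle : H' ≤ H := deleteEdges_le _
    have hedges : edgesIn G H' = edgesIn G H \ {e} := by
      ext x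
      simp [edgesIn, hH', edgeSet_deleteEdges, Subtype.ext_iff]
    have hcard' : (edgesIn G H').ncard = n := by
      rw [hedges, Set.ncard_sdiff_singleton_of_mem he, hcard]
      simp
    have heq := D.picture_eq_union he
    rw [← hH'] at heq
    have hsub : D.picture H' ⊆ D.picture H := D.picture_mono hle
    have hsubA : range (D.curve e) ⊆ D.picture H := heq ▸ subset_union_right
    obtain ⟨g, hg, eg⟩ := ih H' (hH.anti hle) hcard' (hf.mono hsub) fun z hz => h0 z (hsub hz)
    obtain ⟨h, hh, eh⟩ := hasLogOn_arc (D.curve e) (D.curve_injective e) (hf.mono hsubA)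
      fun z hz => h0 z (hsubA hz)
    obtain ⟨m0, m1⟩ := D.curve_ends_mem_picture e H'
    obtain ⟨i, j, hi, hj⟩ := exists_defect (D.curve e) m0 m1 eg eh
    obtain ⟨u, v, huv, hu, hv⟩ := D.exists_ends e
    -- An edge of a forest is a bridge, so its ends lie in the disjoint closed pieces `K₁` and `K₂`.
    -- The logarithm can be shifted on each piece separately to match the arc at both ends.
    have hnr : ¬ H'.Reachable u v := by
      have := isAcyclic_iff_forall_isBridge.1 hH he
      rw [hH', huv]
      rw [huv] at this
      exact isBridge_iff.1 this
    let P : Set V := {w | H'.Reachable u w}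
    let K₁ := D.carrier P {e | e ∈ edgesIn G H' ∧ ∀ w ∈ e.1, w ∈ P}
    let K₂ := D.carrier Pᶜ {e | e ∈ edgesIn G H' ∧ ∀ w ∈ e.1, w ∈ Pᶜ}
    have hK : D.picture H' ⊆ K₁ ∪ K₂ := by
      intro z hz
      rcases D.exists_of_mem_picture hz with ⟨w, rfl⟩ | ⟨e', he', t, -, rfl⟩
      · by_cases hw : w ∈ P
        · exact Or.inl (Or.inl ⟨w, hw, rfl⟩)
        · exact Or.inr (Or.inl ⟨w, hw, rfl⟩)
      · obtain ⟨x, y, hxy, -, -⟩ := D.exists_ends e'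
        have hadj : H'.Adj x y := by
          have : e'.1 ∈ H'.edgeSet := he'
          rwa [hxy] at this
        by_cases hx : x ∈ P
        · have hy : y ∈ P := Reachable.trans hx hadj.reachable
          have hm : e' ∈ {e | e ∈ edgesIn G H' ∧ ∀ w ∈ e.1, w ∈ P} :=
            ⟨he', by rw [hxy]; simp [hx, hy]⟩
          exact Or.inl (D.curve_mem_carrier hm t)
        · have hy : y ∉ P := fun hy => hx (Reachable.trans hy hadj.symm.reachable)
          have hm : e' ∈ {e | e ∈ edgesIn G H' ∧ ∀ w ∈ e.1, w ∈ Pᶜ} :=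
            ⟨he', by rw [hxy]; simp [hx, hy]⟩
          exact Or.inr (D.curve_mem_carrier hm t)
    have hdis : Disjoint K₁ K₂ :=
      D.disjoint_carrier (fun _ h => h.2) (fun _ h => h.2) disjoint_compl_right
    have hK₁ : K₁ ⊆ D.picture H' := D.carrier_mono (subset_univ _) fun _ h => h.1
    have hK₂ : K₂ ⊆ D.picture H' := D.carrier_mono (subset_univ _) fun _ h => h.1
    have hcK₁ : IsClosed K₁ := (D.isCompact_carrier _ _).isClosed
    have hcK₂ : IsClosed K₂ := (D.isCompact_carrier _ _).isClosed
    let g' : ℂ → ℂ := fun z => g z + (if z ∈ K₁ then i else j) * (2 * Real.pi * Complex.I)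
    have e1 : EqOn g' (fun z => g z + i * (2 * Real.pi * Complex.I)) K₁ := fun z hz => by
      simp [g', hz]
    have e2 : EqOn g' (fun z => g z + j * (2 * Real.pi * Complex.I)) K₂ := fun z hz => by
      have : z ∉ K₁ := fun h => Set.disjoint_left.1 hdis h hz
      simp [g', this]
    have hu₁ : D.curve e 0 ∈ K₁ := by
      rw [hu]
      exact Or.inl ⟨u, Reachable.refl u, rfl⟩
    have hv₂ : D.curve e 1 ∈ K₂ := by
      rw [hv]
      exact Or.inl ⟨v, hnr, rfl⟩
    rw [heq]
    refine hasLogOn_union (g := g') (D.isCompact_picture H').isClosed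
      (isCompact_range (D.curve e).continuous).isClosed ?_ hh (fun z hz => ?_) eh ?_
    · exact ((((hg.mono hK₁).add continuousOn_const).congr e1).union_of_isClosed
        (((hg.mono hK₂).add continuousOn_const).congr e2) hcK₁ hcK₂).mono hK
    · rcases hK hz with hz' | hz'
      · rw [e1 hz']
        simp only
        rw [Complex.exp_add, eg z hz, Complex.exp_int_mul_two_pi_mul_I, mul_one]
      · rw [e2 hz']
        simp only
        rw [Complex.exp_add, eg z hz, Complex.exp_int_mul_two_pi_mul_I, mul_one]
    · rintro _ hz ⟨t, rfl⟩
      rcases unitInterval_eq_zero_or_one_or_mem_Ioo t with rfl | rfl | ht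
      · rw [e1 hu₁, hi]
      · rw [e2 hv₂, hj]
      · exact absurd hz (D.curve_notMem_picture (notMem_edgesIn_deleteEdges H e) ht)

/-- The drawing of a forest does not separate the plane. -/
lemma mem_component_of_isAcyclic [Finite V] {H : SimpleGraph V} (hH : H.IsAcyclic) {p q : ℂ}
    (hp : p ∉ D.picture H) (hq : q ∉ D.picture H) :
    q ∈ connectedComponentIn (D.picture H)ᶜ p := by
  have hne : ∀ {w}, w ∉ D.picture H → ∀ z ∈ D.picture H, z - w ≠ 0 := fun hw z hz h =>
    hw (by rwa [← sub_eq_zero.1 h])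
  exact mem_component_of_hasLogOn (D.isCompact_picture H) hp hq
    (D.hasLogOn_picture_of_isAcyclic _ H hH rfl
      (ContinuousOn.div (by fun_prop) (by fun_prop) (hne hq))
      fun z hz => div_ne_zero (hne hp z hz) (hne hq z hz))

/-! ### Incidence of edges and faces. -/

/-- The edges whose arcs meet the closure of the face containing `p` in an interior point. -/
def faceEdges (p : ℂ) : Set G.edgeSet :=
  {e | ∃ t ∈ Ioo (0 : unitInterval) 1,
    D.curve e t ∈ closure (connectedComponentIn (D.picture G)ᶜ p)}

lemma half_mem_Ioo : (⟨1 / 2, by norm_num, by norm_num⟩ : unitInterval) ∈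
    Ioo (0 : unitInterval) 1 := by
  constructor
  · rw [← Subtype.coe_lt_coe]; norm_num
  · rw [← Subtype.coe_lt_coe]; norm_num

/-- The edges at a face contain a cycle. -/
lemma not_isAcyclic_faceEdges [Finite V] (hG : ¬ G.IsAcyclic) {p : ℂ} (hp : p ∉ D.picture G) :
    ¬ (fromEdgeSet (Subtype.val '' D.faceEdges p)).IsAcyclic := by
  set H := fromEdgeSet (Subtype.val '' D.faceEdges p) with hHdef
  intro hH
  have hHG : H ≤ G := by
    rw [hHdef, fromEdgeSet_le]
    rintro _ ⟨⟨e, -, rfl⟩, -⟩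
    exact e.2
  have hfe : ∀ e ∈ D.faceEdges p, e ∈ edgesIn G H := by
    intro e he
    simp only [edgesIn, hHdef, edgeSet_fromEdgeSet, mem_ofPred_eq]
    exact ⟨⟨e, he, rfl⟩, G.not_isDiag_of_mem_edgeSet e.2⟩
  obtain ⟨e, he⟩ : ∃ e : G.edgeSet, e ∉ edgesIn G H := by
    by_contra! h
    exact hG (hH.anti (edgeSet_subset_edgeSet.1 fun e he => h ⟨e, he⟩))
  have hsub := D.picture_mono hHG
  set F := connectedComponentIn (D.picture G)ᶜ p with hF
  have hFo : IsOpen F := (D.isCompact_picture G).isClosed.isOpen_compl.connectedComponentIn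
  have hFG : F ⊆ (D.picture G)ᶜ := connectedComponentIn_subset _ _
  have hpH : p ∉ D.picture H := fun h => hp (hsub h)
  -- The boundary of `F` consists of vertices and points of edges in `faceEdges`, all drawn in `H`,
  -- so `F` is relatively closed off that drawing. A forest does not separate the plane, so `F`
  -- would contain the interior of the edge `e` outside `H`.
  have hpre : connectedComponentIn (D.picture H)ᶜ p ⊆ F := by
    refine isPreconnected_connectedComponentIn.subset_of_closure_inter_subset hFo
      ⟨p, mem_connectedComponentIn hpH, mem_connectedComponentIn hp⟩ ?_
    rintro z ⟨hzF, hz⟩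
    rcases frontier_component_subset (D.isCompact_picture G).isClosed p hzF with h | h
    · exact h
    · refine absurd ?_ (connectedComponentIn_subset _ _ hz)
      rcases D.exists_of_mem_picture h with ⟨v, rfl⟩ | ⟨f, -, t, ht, rfl⟩
      · exact D.pt_mem_picture _ v
      · exact D.curve_mem_carrier (hfe f ⟨t, ht, hzF⟩) t
  have hq : D.curve e _ ∉ D.picture H := D.curve_notMem_picture he half_mem_Ioo
  exact hFG (hpre (D.mem_component_of_isAcyclic hH hpH hq)) (D.curve_mem_carrier e.2 _)

lemma curve_Ioo_subset_component {H : SimpleGraph V} {e : G.edgeSet} (he : e ∉ edgesIn G H)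
    {t : unitInterval} (ht : t ∈ Ioo (0 : unitInterval) 1) :
    D.curve e '' Ioo 0 1 ⊆ connectedComponentIn (D.picture H)ᶜ (D.curve e t) := by
  refine (isPreconnected_Ioo.image _ (D.curve e).continuous.continuousOn).subset_connectedComponentIn
    ⟨t, ht, rfl⟩ ?_
  rintro _ ⟨s, hs, rfl⟩
  exact D.curve_notMem_picture he hs

/-- There are at most two faces at an edge. -/
lemma component_eq_of_mem_faceEdges [Finite V] {e : G.edgeSet} {p q s : ℂ}
    (hp : p ∉ D.picture G) (hq : q ∉ D.picture G) (hs : s ∉ D.picture G)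
    (hep : e ∈ D.faceEdges p) (heq : e ∈ D.faceEdges q) (hes : e ∈ D.faceEdges s) :
    q ∈ connectedComponentIn (D.picture G)ᶜ p ∨ s ∈ connectedComponentIn (D.picture G)ᶜ p ∨
      s ∈ connectedComponentIn (D.picture G)ᶜ q := by
  have hu := D.picture_eq_union (H := G) (e := e) e.2
  have hne := notMem_edgesIn_deleteEdges G e
  set K := D.picture (G.deleteEdges {e.1}) with hK
  have hKc : IsCompact K := D.isCompact_picture _
  have hsub : K ⊆ D.picture G := D.picture_mono (deleteEdges_le _)
  obtain ⟨m0, m1⟩ := D.curve_ends_mem_picture e (G.deleteEdges {e.1})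
  -- Once `e` is deleted, every face at `e` falls into the component that contains the interior of
  -- its arc; restoring the arc splits this component into at most two.
  have key : ∀ r, r ∉ D.picture G → e ∈ D.faceEdges r →
      r ∈ connectedComponentIn Kᶜ (D.curve e ⟨1 / 2, by norm_num, by norm_num⟩) ∧
        r ∉ range (D.curve e) := by
    rintro r hr ⟨t, ht, htr⟩
    refine ⟨?_, fun h => hr (hu ▸ Or.inr h)⟩
    have h1 := D.curve_Ioo_subset_component hne half_mem_Ioo ⟨t, ht, rfl⟩
    rw [connectedComponentIn_eq h1]
    have ho : IsOpen (connectedComponentIn Kᶜ (D.curve e t)) :=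
      hKc.isClosed.isOpen_compl.connectedComponentIn
    obtain ⟨y, hy, hyr⟩ := mem_closure_iff.1 htr _ ho
      (mem_connectedComponentIn (D.curve_notMem_picture hne ht))
    rw [connectedComponentIn_eq hy]
    refine connectedComponentIn_mono y (compl_subset_compl.2 hsub) ?_
    rw [← connectedComponentIn_eq hyr]
    exact mem_connectedComponentIn hr
  obtain ⟨hp1, hp2⟩ := key p hp hep
  obtain ⟨hq1, hq2⟩ := key q hq heq
  obtain ⟨hs1, hs2⟩ := key s hs hes
  rw [hu]
  exact mem_component_or_of_arc hKc (D.curve e) (D.curve_injective e) m0 m1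
    (fun t ht => D.curve_notMem_picture hne ht) hp1 hq1 hs1 hp2 hq2 hs2

/-! ### Euler's inequality. -/

/-- The lower bound for the number of faces in Euler's formula. -/
lemma exists_faces [Finite V] (n : ℕ) :
    ∀ H : SimpleGraph V, H ≤ G → H.Connected → Nat.card H.edgeSet = n →
      ∃ S : Finset ℂ, (∀ p ∈ S, p ∉ D.picture H) ∧
        InjOn (connectedComponentIn (D.picture H)ᶜ) S ∧ n + 2 ≤ S.card + Nat.card V := by
  classical
  induction n with
  | zero =>
    intro H _ hH hcard
    obtain ⟨p, hp⟩ := (ne_univ_iff_exists_notMem _).1 (D.isCompact_picture H).ne_univ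
    refine ⟨{p}, by simpa using hp, by simp, ?_⟩
    have := hH.nonempty
    have : 0 < Nat.card V := Nat.card_pos
    simp
    omega
  | succ n ih =>
    intro H hHG hH hcard
    -- For a tree, `e + 1 = n` and one face is enough. Otherwise a non-bridge is deleted, which
    -- keeps the graph connected, so that its ends are joined in the remaining drawing.
    by_cases hT : H.IsAcyclic
    · obtain ⟨p, hp⟩ := (ne_univ_iff_exists_notMem _).1 (D.isCompact_picture H).ne_univ
      refine ⟨{p}, by simpa using hp, by simp, ?_⟩
      have := (isTree_iff_connected_and_card.1 ⟨hH, hT⟩).2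
      simp
      omega
    rw [isAcyclic_iff_forall_isBridge] at hT
    push Not at hT
    obtain ⟨e, heH, hbr⟩ := hT
    obtain ⟨e, rfl⟩ : ∃ e' : G.edgeSet, e'.1 = e := ⟨⟨e, edgeSet_mono hHG heH⟩, rfl⟩
    obtain ⟨u, v, huv, hu, hv⟩ := D.exists_ends e
    have hconn : (H.deleteEdges {e.1}).Connected := by
      rw [huv] at hbr ⊢
      exact hH.connected_delete_edge_of_not_isBridge hbr
    have hcard' : Nat.card (H.deleteEdges {e.1}).edgeSet = n := by
      rw [edgeSet_deleteEdges, Nat.card_coe_set_eq, Set.ncard_sdiff_singleton_of_mem heH,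
        ← Nat.card_coe_set_eq, hcard]
      simp
    have hle : H.deleteEdges {e.1} ≤ H := deleteEdges_le _
    obtain ⟨S, hS, hinj, hc⟩ := ih _ (hle.trans hHG) hconn hcard'
    have hun := D.picture_eq_union (H := H) (e := e) heH
    have hne := notMem_edgesIn_deleteEdges H e
    have hKc : IsCompact (D.picture (H.deleteEdges {e.1})) := D.isCompact_picture _
    have hab : D.curve e 0 ≠ D.curve e 1 := fun h => zero_ne_one (D.curve_injective e h)
    have jK := D.joinedIn_picture (hle.trans hHG) (hconn.preconnected u v)
    rw [← hu, ← hv] at jK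
    set K := D.picture (H.deleteEdges {e.1}) with hK
    obtain ⟨x, hx⟩ : ∃ x, x = D.curve e ⟨1 / 2, by norm_num, by norm_num⟩ := ⟨_, rfl⟩
    have hAW : range (D.curve e) \ {D.curve e 0, D.curve e 1} ⊆ connectedComponentIn Kᶜ x := by
      rintro _ ⟨⟨t, rfl⟩, ht⟩
      rcases unitInterval_eq_zero_or_one_or_mem_Ioo t with rfl | rfl | ht'
      · exact absurd (Or.inl rfl) ht
      · exact absurd (Or.inr rfl) ht
      · rw [hx]
        exact D.curve_Ioo_subset_component hne half_mem_Ioo ⟨t, ht', rfl⟩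
    obtain ⟨p, ⟨hpW, hpA⟩, q, ⟨hqW, hqA⟩, hpq⟩ := exists_separated_of_arc hKc.isClosed
      (isCompact_range (D.curve e).continuous).isClosed hab jK (D.joinedIn_curve e) hAW
    obtain ⟨m0, m1⟩ := D.curve_ends_mem_picture e (H.deleteEdges {e.1})
    set W := connectedComponentIn Kᶜ x with hW
    have hWK : W ⊆ Kᶜ := connectedComponentIn_subset _ _
    rw [← hun] at hpq
    have hsubK : (D.picture H)ᶜ ⊆ Kᶜ := by
      rw [hun]
      exact compl_subset_compl.2 subset_union_left
    have hp : p ∉ D.picture H := by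
      rw [hun]
      exact fun h => h.elim (hWK hpW) hpA
    have hq : q ∉ D.picture H := by
      rw [hun]
      exact fun h => h.elim (hWK hqW) hqA
    have hsH : ∀ s ∈ S.filter (· ∉ W), s ∉ D.picture H := by
      intro s hs
      rw [Finset.mem_filter] at hs
      rw [hun]
      rintro (h | h)
      · exact hS s hs.1 h
      · refine hs.2 (hAW ⟨h, ?_⟩)
        rintro (rfl | rfl)
        · exact hS _ hs.1 m0
        · exact hS _ hs.1 m1
    have up : ∀ {y z}, y ∉ D.picture H → z ∉ D.picture H →
        connectedComponentIn (D.picture H)ᶜ y = connectedComponentIn (D.picture H)ᶜ z →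
        connectedComponentIn Kᶜ y = connectedComponentIn Kᶜ z := by
      intro y z hy hz h
      refine connectedComponentIn_eq (connectedComponentIn_mono y hsubK ?_)
      rw [h]
      exact mem_connectedComponentIn hz
    have hWy : ∀ {y}, y ∈ W → connectedComponentIn Kᶜ y = W := fun hy =>
      (connectedComponentIn_eq hy).symm
    have hout : ∀ {y}, y ∈ W → y ∉ D.picture H → ∀ s ∈ S.filter (· ∉ W),
        connectedComponentIn (D.picture H)ᶜ y ≠ connectedComponentIn (D.picture H)ᶜ s := by
      intro y hyW hy s hs h
      have := up hy (hsH s hs) h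
      rw [hWy hyW] at this
      refine (Finset.mem_filter.1 hs).2 ?_
      rw [this]
      exact mem_connectedComponentIn (hS s (Finset.mem_filter.1 hs).1)
    have hpq' : connectedComponentIn (D.picture H)ᶜ p ≠ connectedComponentIn (D.picture H)ᶜ q :=
      fun h => hpq (h ▸ mem_connectedComponentIn hq)
    have hqS : q ∉ S.filter (· ∉ W) := fun h => (Finset.mem_filter.1 h).2 hqW
    have hpS : p ∉ insert q (S.filter (· ∉ W)) := by
      rw [Finset.mem_insert]
      rintro (rfl | h)
      · exact hpq' rfl
      · exact (Finset.mem_filter.1 h).2 hpW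
    -- The old representatives contain at most one point of `W`. It is replaced by `p` and `q`,
    -- which the new arc separates, so the count grows by at least one.
    refine ⟨insert p (insert q (S.filter (· ∉ W))), ?_, ?_, ?_⟩
    · intro s hs
      simp only [Finset.mem_insert] at hs
      rcases hs with rfl | rfl | hs
      · exact hp
      · exact hq
      · exact hsH s hs
    · intro y hy z hz h
      simp only [Finset.coe_insert, mem_insert_iff, Finset.mem_coe] at hy hz
      rcases hy with rfl | rfl | hy <;> rcases hz with rfl | rfl | hz
      · rfl
      · exact absurd h hpq'
      · exact absurd h (hout hpW hp z hz)
      · exact absurd h.symm hpq'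
      · rfl
      · exact absurd h (hout hqW hq z hz)
      · exact absurd h.symm (hout hpW hp y hy)
      · exact absurd h.symm (hout hqW hq y hy)
      · exact hinj (Finset.mem_filter.1 hy).1 (Finset.mem_filter.1 hz).1
          (up (hsH y hy) (hsH z hz) h)
    · rw [Finset.card_insert_of_notMem hpS, Finset.card_insert_of_notMem hqS]
      have h1 : (S.filter (· ∈ W)).card ≤ 1 := by
        rw [Finset.card_le_one]
        intro y hy z hz
        rw [Finset.mem_filter] at hy hz
        exact hinj hy.1 hz.1 ((hWy hy.2).trans (hWy hz.2).symm)
      have h2 := Finset.card_filter_add_card_filter_not (s := S) (· ∈ W)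
      omega

end SimpleGraph.PlaneDrawing

/-! ### The edge bound for triangle-free planar graphs. -/

namespace SimpleGraph

/-- A planar connected graph without triangles that is not a tree has at most `2n - 4` edges. -/
theorem IsPlanar.card_edgeSet_add_four_le {V : Type*} {G : SimpleGraph V} [Finite V]
    (hP : G.IsPlanar) (hconn : G.Connected) (hG : ¬ G.IsAcyclic)
    (h3 : G.CliqueFree 3) : Nat.card G.edgeSet + 4 ≤ 2 * Nat.card V := by
  classical
  obtain ⟨D⟩ := hP
  obtain ⟨S, hS, hinj, hc⟩ := D.exists_faces _ G le_rfl hconn rfl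
  have := Fintype.ofFinite G.edgeSet
  -- Double counting gives `4f ≤ 2e`, since a cycle at a face has length at least `4`; with `e + 2 ≤
  -- f + n` this yields `e + 4 ≤ 2n`.
  have hcount := Finset.card_mul_le_card_mul (s := S) (t := (Finset.univ : Finset G.edgeSet))
    (m := 4) (n := 2) (fun p e => e ∈ D.faceEdges p) ?_ ?_
  · rw [Finset.card_univ, ← Nat.card_eq_fintype_card] at hcount
    omega
  · intro p hp
    have hcyc := D.not_isAcyclic_faceEdges hG (hS p hp)
    set H := fromEdgeSet (Subtype.val '' D.faceEdges p) with hHdef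
    have hHG : H ≤ G := by
      rw [hHdef, fromEdgeSet_le]
      rintro _ ⟨⟨e, -, rfl⟩, -⟩
      exact e.2
    unfold IsAcyclic at hcyc
    push Not at hcyc
    obtain ⟨v, c, hc⟩ := hcyc
    have hlen : 4 ≤ c.length := by
      have h3' := hc.three_le_length
      have : c.length ≠ 3 := fun h => by
        obtain ⟨s, hs⟩ := is3Clique_iff_exists_cycle_length_three.2 ⟨v, c, hc, h⟩
        exact h3 s (hs.mono hHG)
      omega
    have hsub : c.edges.toFinset ⊆
        (Finset.bipartiteAbove (fun p e => e ∈ D.faceEdges p) Finset.univ p).map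
          (Function.Embedding.subtype _) := by
      intro e he
      have he' : e ∈ H.edgeSet := c.edges_subset_edgeSet (List.mem_toFinset.1 he)
      rw [hHdef, edgeSet_fromEdgeSet] at he'
      obtain ⟨⟨f, hf, rfl⟩, -⟩ := he'
      simpa [Finset.bipartiteAbove] using hf
    have := Finset.card_le_card hsub
    rw [Finset.card_map, List.toFinset_card_of_nodup hc.isTrail.edges_nodup,
      Walk.length_edges] at this
    omega
  · intro e _
    by_contra! h
    obtain ⟨p, q, s, hp, hq, hs, hpq, hps, hqs⟩ := Finset.two_lt_card_iff.1 h
    simp only [Finset.mem_bipartiteBelow] at hp hq hs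
    rcases D.component_eq_of_mem_faceEdges (hS p hp.1) (hS q hq.1) (hS s hs.1) hp.2 hq.2 hs.2
      with h | h | h
    · exact hpq (hinj hp.1 hq.1 (connectedComponentIn_eq h))
    · exact hps (hinj hp.1 hs.1 (connectedComponentIn_eq h))
    · exact hqs (hinj hq.1 hs.1 (connectedComponentIn_eq h))

end SimpleGraph

end PlaneTopology

/-! ### Counting in basic Laman graphs. -/

namespace SimpleGraph

section Laman

variable {V : Type*} {G : SimpleGraph V}

lemma Subgraph.freedomNumber_coe (S : G.Subgraph) :
    S.coe.freedomNumber = 2 * (S.verts.ncard : ℤ) - (S.edgeSet.ncard : ℤ) - 3 := by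
  have h : Nat.card S.coe.edgeSet = S.edgeSet.ncard := by
    rw [← S.image_coe_edgeSet_coe,
      Set.ncard_image_of_injective _ (Sym2.map.injective Subtype.val_injective),
      Nat.card_coe_set_eq]
  rw [freedomNumber, h, Nat.card_coe_set_eq]

lemma Subgraph.freedomNumber_coe_coeSubgraph {S : G.Subgraph} (T : S.coe.Subgraph) :
    (Subgraph.coeSubgraph T).coe.freedomNumber = T.coe.freedomNumber := by
  rw [Subgraph.freedomNumber_coe, Subgraph.freedomNumber_coe]
  have hv : (Subgraph.coeSubgraph T).verts.ncard = T.verts.ncard :=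
    Set.ncard_image_of_injective _ Subtype.val_injective
  have he : (Subgraph.coeSubgraph T).edgeSet.ncard = T.edgeSet.ncard := by
    rw [Subgraph.coeSubgraph, Subgraph.edgeSet_map]
    exact Set.ncard_image_of_injective _ (Sym2.map.injective Subtype.val_injective)
  rw [hv, he]

/-- Independence is inherited, because a proper subgraph of `S` is also a proper subgraph of `G`. -/
lemma IsLaman.coe_of_freedomNumber_eq_zero (hG : G.IsLaman) {S : G.Subgraph} (hS : S.IsProper)
    (h0 : S.coe.freedomNumber = 0) : S.coe.IsLaman := by
  refine ⟨⟨h0.ge, fun T hT => ?_⟩, h0⟩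
  rw [← Subgraph.freedomNumber_coe_coeSubgraph]
  refine hG.1.2 _ ⟨fun htop => hS.1 (top_le_iff.1 (htop ▸ Subgraph.coeSubgraph_le T)), ?_⟩
  rw [Nat.card_coe_set_eq]
  have hv : (Subgraph.coeSubgraph T).verts.ncard = T.verts.ncard :=
    Set.ncard_image_of_injective _ Subtype.val_injective
  rw [hv, ← Nat.card_coe_set_eq]
  exact hT.2

lemma IsBasicLaman.one_le_freedomNumber (hG : G.IsBasicLaman) {S : G.Subgraph}
    (hS : S.IsProper) : 1 ≤ S.coe.freedomNumber := by
  have h1 := hG.1.1.2 S hS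
  have h2 : S.coe.freedomNumber ≠ 0 := fun h =>
    hG.2 S hS (hG.1.coe_of_freedomNumber_eq_zero hS h)
  omega

variable [Finite V]

lemma IsBasicLaman.isMConnected_three (hG : G.IsBasicLaman) (hV : 3 < Nat.card V) :
    G.IsMConnected 3 := by
  refine ⟨hV, fun U hU => ?_⟩
  rintro ⟨a, b, ha, hb, hsep⟩
  -- `A` is what can be reached from `a` off `U`. No edge leaves `A` except into `U`, so the
  -- subgraphs induced on `A ∪ U` and `Aᶜ` cover all edges.
  let A : Set V := {x | ∃ w : G.Walk a x, ∀ y ∈ w.support, y ∉ U}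
  have haA : a ∈ A := ⟨Walk.nil, by simpa using ha⟩
  have hAU : ∀ x ∈ A, x ∉ U := fun x ⟨w, hw⟩ => hw x w.end_mem_support
  have hbA : b ∉ A := by
    rintro ⟨w, hw⟩
    obtain ⟨x, hx, hxU⟩ := hsep w
    exact hw x hx hxU
  have hstep : ∀ x ∈ A, ∀ y, G.Adj x y → y ∈ A ∪ U := by
    rintro x ⟨w, hw⟩ y hxy
    by_cases hy : y ∈ U
    · exact Or.inr hy
    · refine Or.inl ⟨w.concat hxy, fun z hz => ?_⟩
      rw [Walk.support_concat, List.mem_append, List.mem_singleton] at hz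
      rcases hz with hz | rfl
      · exact hw z hz
      · exact hy
  let S₁ : G.Subgraph := (⊤ : G.Subgraph).induce (A ∪ U)
  let S₂ : G.Subgraph := (⊤ : G.Subgraph).induce Aᶜ
  have hdisj : Disjoint A (U : Set V) := Set.disjoint_left.2 hAU
  have hU2 : (U : Set V).ncard = 2 := by
    rw [Set.ncard_coe_finset]
    omega
  have hv₁ : S₁.verts.ncard = A.ncard + 2 := by
    rw [← hU2]
    exact Set.ncard_union_eq hdisj
  have hv₂ : A.ncard + S₂.verts.ncard = Nat.card V := Set.ncard_add_ncard_compl A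
  have hA : 0 < A.ncard := (Set.ncard_pos).2 ⟨a, haA⟩
  have hv₂' : 3 ≤ S₂.verts.ncard := by
    have hsub : insert b (U : Set V) ⊆ S₂.verts := by
      rintro x (rfl | hx)
      · exact hbA
      · exact fun h => hAU x h hx
    have := Set.ncard_le_ncard hsub
    rwa [Set.ncard_insert_of_notMem (by exact_mod_cast hb), hU2] at this
  have hp₁ : S₁.IsProper := by
    refine ⟨fun h => ?_, by rw [Nat.card_coe_set_eq]; omega⟩
    have : b ∈ S₁.verts := h ▸ Set.mem_univ b
    exact this.elim hbA hb
  have hp₂ : S₂.IsProper := by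
    refine ⟨fun h => ?_, by rw [Nat.card_coe_set_eq]; omega⟩
    have : a ∈ S₂.verts := h ▸ Set.mem_univ a
    exact this haA
  have hedges : G.edgeSet ⊆ S₁.edgeSet ∪ S₂.edgeSet := by
    intro e
    induction e using Sym2.ind with
    | _ x y =>
      intro hxy
      rw [mem_edgeSet] at hxy
      by_cases hx : x ∈ A
      · exact Or.inl ⟨Or.inl hx, hstep x hx y hxy, hxy⟩
      by_cases hy : y ∈ A
      · exact Or.inl ⟨hstep y hy x hxy.symm, Or.inl hy, hxy⟩
      · exact Or.inr ⟨hx, hy, hxy⟩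
  have he : G.edgeSet.ncard ≤ S₁.edgeSet.ncard + S₂.edgeSet.ncard :=
    (Set.ncard_le_ncard hedges).trans (Set.ncard_union_le _ _)
  have h₁ := hG.one_le_freedomNumber hp₁
  have h₂ := hG.one_le_freedomNumber hp₂
  have h₀ := hG.1.2
  rw [Subgraph.freedomNumber_coe] at h₁ h₂
  rw [freedomNumber, Nat.card_coe_set_eq] at h₀
  -- The vertex counts add up to `n + 2` and the edge counts to at least `e`, so the freedom numbers
  -- add up to at most `2(n + 2) - e - 6 = 1`, against `1 + 1`.
  omega

/-- If `a` and `b` were in different components, any two other vertices would separate them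
vacuously; more than three vertices provide such a pair. -/
lemma IsMConnected.connected (h : G.IsMConnected 3) : G.Connected := by
  classical
  have : Nonempty V := Nat.card_pos_iff.1 (by have := h.1; omega) |>.1
  refine ⟨fun a b => ?_⟩
  by_contra hab
  have := Fintype.ofFinite V
  have hcard : 2 ≤ (Finset.univ \ {a, b} : Finset V).card := by
    have h1 := Finset.le_card_sdiff ({a, b} : Finset V) Finset.univ
    have h2 : ({a, b} : Finset V).card ≤ 2 := Finset.card_le_two
    have h3 := h.1
    rw [Nat.card_eq_fintype_card] at h3
    rw [Finset.card_univ] at h1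
    omega
  obtain ⟨U, hU, hU2⟩ := Finset.exists_subset_card_eq hcard
  refine h.2 U (by omega) ⟨a, b, fun ha => ?_, fun hb => ?_, fun w => absurd ⟨w⟩ hab⟩
  · simpa using hU ha
  · simpa using hU hb

lemma IsBasicLaman.cliqueFree_three (hG : G.IsBasicLaman) (hV : 3 < Nat.card V) :
    G.CliqueFree 3 := by
  classical
  intro s hs
  let S : G.Subgraph := (⊤ : G.Subgraph).induce s
  have hv : S.verts.ncard = 3 := by
    rw [← hs.card_eq]
    exact Set.ncard_coe_finset s
  have hp : S.IsProper := by
    refine ⟨fun h => ?_, by rw [Nat.card_coe_set_eq, hv]⟩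
    rw [h, Subgraph.verts_top, Set.ncard_univ] at hv
    omega
  obtain ⟨a, b, c, hab, hac, hbc, rfl⟩ := is3Clique_iff.1 hs
  have hsub : (({s(a, b), s(a, c), s(b, c)} : Finset (Sym2 V)) : Set (Sym2 V)) ⊆ S.edgeSet := by
    intro e he
    simp only [Finset.coe_insert, Finset.coe_singleton, Set.mem_insert_iff,
      Set.mem_singleton_iff] at he
    rcases he with rfl | rfl | rfl <;> simp [S, hab, hac, hbc]
  have hcard : ({s(a, b), s(a, c), s(b, c)} : Finset (Sym2 V)).card = 3 := by
    have := hab.ne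
    have := hac.ne
    have := hbc.ne
    rw [Finset.card_eq_three]
    exact ⟨_, _, _, by grind, by grind, by grind, rfl⟩
  have he := Set.ncard_le_ncard hsub
  rw [Set.ncard_coe_finset, hcard] at he
  have h₁ := hG.one_le_freedomNumber hp
  rw [Subgraph.freedomNumber_coe] at h₁
  omega

end Laman

end SimpleGraph

theorem mainTheorem2 {V : Type*} [Finite V] (G : SimpleGraph V) (hG : G.IsBasicLaman)
    (hV : 3 < Nat.card V) : G.IsMConnected 3 ∧ ¬ G.IsPlanar := by
  have h3 := hG.isMConnected_three hV
  have hfree := hG.1.2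
  rw [SimpleGraph.freedomNumber] at hfree
  refine ⟨h3, fun hP => ?_⟩
  -- A tree has `n - 1` edges, and `n - 1 = 2n - 3` forces `n = 2`.
  have hacyc : ¬ G.IsAcyclic := fun h => by
    have := (SimpleGraph.isTree_iff_connected_and_card.1 ⟨h3.connected, h⟩).2
    omega
  have := hP.card_edgeSet_add_four_le h3.connected hacyc (hG.cliqueFree_three hV)
  omega
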